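/- For integers $n,l\ge 1$ let $R_{n,l}$ be the triangulated parallelogram with $n$ rows of $l$ vertices: its vertices are the pairs $(i,j)$ with $0\le i<n$, $0\le j<l$, and $(i,j)$ is joined by an edge to each of $(i,j+1)$, $(i+1,j)$, $(i+1,j+1)$ that is a vertex. Let $R_n=R_{n,n}$. Consider $k$ lions on a finite simple graph $G=(V,E)$. Each lion occupies a vertex, and several lions may occupy the same vertex. At each time step $t\to t+1$ every lion either stays where it is or moves to an adjacent vertex. Let $C(t)\subseteq V$ be the set of cleared vertices at time $t$; all other vertices are contaminated. $C(0)$ is the set of vertices occupied by lions at time $0$. A vertex is in $C(t+1)$ if and only if it is occupied by a lion at time $t+1$, or it is in $C(t)$ and does not become recontaminated. Here a vertex $v\in C(t)$ becomes recontaminated if it is not occupied by a lion at time $t+1$ and it has a neighbour $u\notin C(t)$ such that no lion moves from $v$ to $u$ between times $t$ and $t+1$. The $k$ lions can clear $G$ if, for some choice of starting positions and moves, $C(t)=V$ for some $t\ge 0$. **Theorem.** Let $n\ge 1$. Then $\lfloor n/2\rfloor$ lions (or fewer) cannot clear $R_n$, whatever their starting positions and moves. -/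

import Mathlib

namespace Lions

/-- The triangulated parallelogram of height `n` vertices and length `l` vertices, drawn as a
grid of unit squares (rows `Fin n`, columns `Fin l`), each cut by the diagonal from its top left
to its bottom right corner: `(i, j)` is joined to `(i, j + 1)`, `(i + 1, j)` and
`(i + 1, j + 1)` whenever these are vertices. -/
def triangularLattice (n l : ℕ) : SimpleGraph (Fin n × Fin l) :=
  SimpleGraph.fromRel fun a b =>
    (b.1.val = a.1.val ∧ b.2.val = a.2.val + 1) ∨
    (b.1.val = a.1.val + 1 ∧ b.2.val = a.2.val) ∨
    (b.1.val = a.1.val + 1 ∧ b.2.val = a.2.val + 1)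

/-- The triangulated rhombus with `n` vertices on each side. -/
def rhombus (n : ℕ) : SimpleGraph (Fin n × Fin n) := triangularLattice n n

variable {V : Type*}

/-- A legal motion of `k` lions: `p t i` is the position of lion `i` at time `t`. At each turn
every lion stays where it is or moves along an edge; lions may share a vertex. -/
def IsMotion (G : SimpleGraph V) {k : ℕ} (p : ℕ → Fin k → V) : Prop :=
  ∀ t i, p (t + 1) i = p t i ∨ G.Adj (p t i) (p (t + 1) i)

/-- If `C` is the set of cleared vertices at some time and the lions move from `p` to `q`, then
contamination spreads to `v` when `v` is not occupied by a lion after the move, and `v` has a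
contaminated neighbour `u` such that no lion crosses the edge from `v` to `u`. -/
def Recontaminated (G : SimpleGraph V) {k : ℕ} (C : Set V) (p q : Fin k → V) (v : V) : Prop :=
  (∀ i, q i ≠ v) ∧ ∃ u, u ∉ C ∧ G.Adj v u ∧ ¬ ∃ i, p i = v ∧ q i = u

/-- The set of cleared vertices at time `t`. At time `0` these are the vertices occupied by
lions; afterwards, a vertex is cleared if a lion occupies it, or if it was cleared before and
does not become recontaminated. -/
def cleared (G : SimpleGraph V) {k : ℕ} (p : ℕ → Fin k → V) : ℕ → Set V
  | 0 => Set.range (p 0)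
  | t + 1 => Set.range (p (t + 1)) ∪
      {v | v ∈ cleared G p t ∧ ¬ Recontaminated G (cleared G p t) (p t) (p (t + 1)) v}

/-- `k` lions can clear `G`: for some starting positions and some legal motion, all vertices
are cleared at some time. -/
def CanClear (G : SimpleGraph V) (k : ℕ) : Prop :=
  ∃ p : ℕ → Fin k → V, IsMotion G p ∧ ∃ t, cleared G p t = Set.univ

end Lions

namespace Lions

open Finset

/-! The invariant is 2|C(t)| ≤ n(n-1) + 2k, which stays at most n² because 2k ≤ n. One step adds at
most k vertices, so only n(n-1) < 2|C(t)| ≤ n² needs care. There `isoperimetric` gives C(t) at least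
n vertices with a contaminated neighbour, while k lions can make up for only 2k ≤ n such losses, so
C(t) does not grow. -/

/-- A property that can only change along consecutive elements of `Fin n` where one of them
satisfies `Q` is constant on intervals avoiding `Q`. -/
theorem iff_of_forall_step {n : ℕ} {P Q : Fin n → Prop}
    (h : ∀ a b : Fin n, b.val = a.val + 1 → ¬ Q a → ¬ Q b → (P a ↔ P b))
    {a b : Fin n} (hab : a ≤ b) (hQ : ∀ r, a ≤ r → r ≤ b → ¬ Q r) : P a ↔ P b := by
  obtain ⟨d, hd⟩ := Nat.exists_eq_add_of_le (Fin.le_def.1 hab)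
  induction d generalizing b with
  | zero => rw [Fin.ext (by simpa using hd) (a := b)]
  | succ d ih =>
    have hlt : a.val + d < n := by have := b.isLt; omega
    have hle : (⟨a.val + d, hlt⟩ : Fin n) ≤ b := Fin.le_def.2 (by simp only; omega)
    have hle' : a ≤ (⟨a.val + d, hlt⟩ : Fin n) := Fin.le_def.2 (by simp)
    refine (ih hle' (fun r h1 h2 => hQ r h1 (h2.trans hle)) rfl).trans ?_
    exact h _ _ (by simp only; omega) (hQ _ hle' hle) (hQ _ hab le_rfl)

/-- With each positive `b i` equal to 1, the nonzero `x i` are at most 1, 2, 3, ..., which gives the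
triangular number; a larger `b i` only helps. -/
theorem two_mul_sum_le {ι : Type*} [LinearOrder ι] (s : Finset ι) (x b : ι → ℕ)
    (hx : ∀ i ∈ s, x i ≤ ∑ r ∈ s with r ≤ i, b r) (hb : ∀ i ∈ s, x i = 0 ∨ 1 ≤ b i) :
    2 * ∑ i ∈ s, x i ≤ (∑ i ∈ s, b i) * (∑ i ∈ s, b i + 1) := by
  induction s using Finset.induction_on_max with
  | empty => simp
  | insert a s ha ih =>
    have hna : a ∉ s := fun h => lt_irrefl _ (ha a h)
    have ih' := ih (fun i hi => by
      have := hx i (mem_insert_of_mem hi)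
      rwa [filter_insert, if_neg (not_le.2 (ha i hi))] at this)
      (fun i hi => hb i (mem_insert_of_mem hi))
    have h1 : x a ≤ ∑ i ∈ insert a s, b i :=
      (hx a (mem_insert_self a s)).trans (sum_le_sum_of_subset (filter_subset _ _))
    rw [sum_insert hna] at h1 ⊢
    rw [sum_insert hna]
    rcases hb a (mem_insert_self a s) with h0 | h0
    · rw [h0, zero_add]
      refine ih'.trans (Nat.mul_le_mul ?_ ?_) <;> omega
    · obtain ⟨d, hd⟩ := Nat.exists_eq_add_of_le' h0
      rw [hd] at h1 ⊢
      generalize ∑ i ∈ s, b i = S at *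
      nlinarith [Nat.zero_le (d * S), Nat.zero_le (d * d)]

theorem two_mul_sum_le_dual {ι : Type*} [LinearOrder ι] (s : Finset ι) (x b : ι → ℕ)
    (hx : ∀ i ∈ s, x i ≤ ∑ r ∈ s with i ≤ r, b r) (hb : ∀ i ∈ s, x i = 0 ∨ 1 ≤ b i) :
    2 * ∑ i ∈ s, x i ≤ (∑ i ∈ s, b i) * (∑ i ∈ s, b i + 1) :=
  two_mul_sum_le (ι := ιᵒᵈ) s x b hx hb

/-! ### Isoperimetry in the grid -/

/-- Triangular bound for a set `X` missing a row and a column, in terms of a set `B` that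
separates `X` from its complement. -/
theorem two_mul_card_le_of_disjoint_row_col {n : ℕ} (X B : Finset (Fin n × Fin n))
    (hrow : ∀ i j j' : Fin n, j'.val = j.val + 1 → (i, j) ∉ B → (i, j') ∉ B →
      ((i, j) ∈ X ↔ (i, j') ∈ X))
    (hcol : ∀ j i i' : Fin n, i'.val = i.val + 1 → (i, j) ∉ B → (i', j) ∉ B →
      ((i, j) ∈ X ↔ (i', j) ∈ X))
    (e f : Fin n) (he : ∀ j, (e, j) ∉ X) (hf : ∀ i, (i, f) ∉ X) (heB : ∀ j, (e, j) ∉ B) :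
    2 * #X ≤ #B * (#B + 1) := by
  have card_fiber (Y : Finset (Fin n × Fin n)) : #Y = ∑ i, #{j | (i, j) ∈ Y} := by
    rw [card_eq_sum_card_fiberwise (f := Prod.fst) (t := univ) (fun _ _ => by simp)]
    refine sum_congr rfl fun i _ => ?_
    refine card_bij' (fun v _ => v.2) (fun j _ => (i, j)) ?_ ?_ ?_ ?_ <;>
      simp +contextual [eq_comm]
  have hsplit (g : Fin n → ℕ) : ∑ i, g i = ∑ i ∈ Ioi e, g i + ∑ i ∈ Iio e, g i + g e := by
    rw [← sum_disjUnion (by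
      rw [Finset.disjoint_left]; intro i; simp only [mem_Ioi, mem_Iio]; exact lt_asymm)]
    have : univ = insert e ((Ioi e).disjUnion (Iio e) (by
      rw [Finset.disjoint_left]; intro i; simp only [mem_Ioi, mem_Iio]; exact lt_asymm)) := by
      ext i; simp; grind
    rw [this, sum_insert (by simp), add_comm]
  set x : Fin n → ℕ := fun i => #{j | (i, j) ∈ X} with hx
  set b : Fin n → ℕ := fun i => #{j | (i, j) ∈ B} with hb
  have hxe : x e = 0 := by simp [hx, he]
  have hbe : b e = 0 := by simp [hb, heB]
  -- A row that meets `X` but not `B` would lie in `X` as far as column `f`.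
  have hpos (i : Fin n) : x i = 0 ∨ 1 ≤ b i := by
    by_contra! hcon
    obtain ⟨hxi, hbi⟩ := hcon
    have hB : ∀ j, (i, j) ∉ B := by
      simpa [hb, filter_eq_empty_iff] using (Nat.lt_one_iff.1 hbi)
    obtain ⟨j, hj⟩ := card_ne_zero.1 hxi
    have hj' : (i, j) ∈ X := by simpa using hj
    rcases le_total j f with h | h
    · exact hf i ((iff_of_forall_step (P := fun j => (i, j) ∈ X) (Q := fun j => (i, j) ∈ B)
        (hrow i) h (fun r _ _ => hB r)).1 hj')
    · exact hf i ((iff_of_forall_step (P := fun j => (i, j) ∈ X) (Q := fun j => (i, j) ∈ B)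
        (hrow i) h (fun r _ _ => hB r)).2 hj')
  have hcover (i : Fin n) (S : Finset (Fin n))
      (h : ∀ j, (i, j) ∈ X → ∃ r ∈ S, (r, j) ∈ B) : x i ≤ ∑ r ∈ S, b r := by
    refine (card_le_card (t := S.biUnion fun r => {j | (r, j) ∈ B}) ?_).trans card_biUnion_le
    intro j hj
    simpa using h j (by simpa using hj)
  -- Going from a vertex of `X` along its column to row `e`, one must meet `B`.
  have hup := two_mul_sum_le (Ioi e) x b (fun i hi => by
    refine hcover i _ fun j hj => ?_
    by_contra! hcon
    refine he j ((iff_of_forall_step (P := fun i => (i, j) ∈ X) (Q := fun i => (i, j) ∈ B)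
        (hcol j) (mem_Ioi.1 hi).le (fun r h1 h2 => ?_)).2 hj)
    rcases h1.eq_or_lt with rfl | h1
    · exact heB j
    · exact hcon r (by simp [h1, h2])) (fun i _ => hpos i)
  have hlow : ∀ i ∈ Iio e, x i ≤ ∑ r ∈ Iio e with i ≤ r, b r := fun i hi => by
    refine hcover i _ fun j hj => ?_
    by_contra! hcon
    refine he j ((iff_of_forall_step (P := fun i => (i, j) ∈ X) (Q := fun i => (i, j) ∈ B)
        (hcol j) (mem_Iio.1 hi).le (fun r h1 h2 => ?_)).1 hj)
    rcases h2.eq_or_lt with rfl | h2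
    · exact heB j
    · exact hcon r (by simp [h1, h2])
  have hdown := two_mul_sum_le_dual (Iio e) x b hlow (fun i _ => hpos i)
  rw [card_fiber X, card_fiber B]
  change 2 * ∑ i, x i ≤ (∑ i, b i) * (∑ i, b i + 1)
  rw [hsplit x, hsplit b, hxe, hbe]
  -- s(s+1) is superadditive, so the bounds for the two sides of row `e` combine.
  nlinarith [Nat.zero_le ((∑ i ∈ Ioi e, b i) * ∑ i ∈ Iio e, b i)]

/-- Isoperimetric inequality in the square grid: a set separated from its complement by fewer
than `n` vertices is small, or its complement is. -/
theorem isoperimetric {n : ℕ} (X B : Finset (Fin n × Fin n))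
    (hrow : ∀ i j j' : Fin n, j'.val = j.val + 1 → (i, j) ∉ B → (i, j') ∉ B →
      ((i, j) ∈ X ↔ (i, j') ∈ X))
    (hcol : ∀ j i i' : Fin n, i'.val = i.val + 1 → (i, j) ∉ B → (i', j) ∉ B →
      ((i, j) ∈ X ↔ (i', j) ∈ X))
    (hB : #B < n) :
    2 * #X ≤ (n - 1) * n ∨ 2 * #Xᶜ ≤ (n - 1) * n := by
  -- Fewer than `n` vertices miss some row `e` and some column `f`; this cross lies wholly in `X` or
  -- wholly in its complement.
  have avoid (g : Fin n × Fin n → Fin n) : ∃ i, ∀ v ∈ B, g v ≠ i := by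
    have h : #(B.image g) < #(univ : Finset (Fin n)) := by
      simpa using card_image_le.trans_lt hB
    obtain ⟨i, -, hi⟩ := exists_mem_notMem_of_card_lt_card h
    exact ⟨i, fun v hv hvi => hi (mem_image.2 ⟨v, hv, hvi⟩)⟩
  obtain ⟨e, he⟩ := avoid Prod.fst
  obtain ⟨f, hf⟩ := avoid Prod.snd
  have heB : ∀ j, (e, j) ∉ B := fun j h => he _ h rfl
  have hfB : ∀ i, (i, f) ∉ B := fun i h => hf _ h rfl
  have hec (j : Fin n) : (e, j) ∈ X ↔ (e, f) ∈ X := by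
    rcases le_total j f with h | h
    · exact iff_of_forall_step (P := fun j => (e, j) ∈ X) (hrow e) h (fun r _ _ => heB r)
    · exact (iff_of_forall_step (P := fun j => (e, j) ∈ X) (hrow e) h (fun r _ _ => heB r)).symm
  have hfc (i : Fin n) : (i, f) ∈ X ↔ (e, f) ∈ X := by
    rcases le_total i e with h | h
    · exact iff_of_forall_step (P := fun i => (i, f) ∈ X) (hcol f) h (fun r _ _ => hfB r)
    · exact (iff_of_forall_step (P := fun i => (i, f) ∈ X) (hcol f) h (fun r _ _ => hfB r)).symm
  have hm : #B * (#B + 1) ≤ (n - 1) * n := Nat.mul_le_mul (by omega) (by omega)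
  by_cases hX : (e, f) ∈ X
  · refine Or.inr (le_trans ?_ hm)
    refine two_mul_card_le_of_disjoint_row_col _ B ?_ ?_ e f ?_ ?_ heB
    · intro i j j' h h1 h2
      simpa using not_congr (hrow i j j' h h1 h2)
    · intro j i i' h h1 h2
      simpa using not_congr (hcol j i i' h h1 h2)
    · intro j; simpa [hec] using hX
    · intro i; simpa [hfc] using hX
  · refine Or.inl (le_trans ?_ hm)
    exact two_mul_card_le_of_disjoint_row_col X B hrow hcol e f
      (fun j => by rwa [hec]) (fun i => by rwa [hfc]) heB

/-! ### Growth of the cleared set in one step -/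

/-- The vertices of `C` with a neighbour outside `C`. -/
def innerBoundary {V : Type*} (G : SimpleGraph V) (C : Set V) : Set V :=
  {v | v ∈ C ∧ ∃ u, u ∉ C ∧ G.Adj v u}

theorem ncard_range_le {V : Type*} {k : ℕ} (q : Fin k → V) : (Set.range q).ncard ≤ k := by
  rw [← Set.image_univ]
  exact (Set.ncard_image_le Set.finite_univ).trans (by simp [Set.ncard_univ])

theorem ncard_cleared_succ_le {V : Type*} [Finite V] (G : SimpleGraph V) {k : ℕ}
    (p : ℕ → Fin k → V) (t : ℕ) :
    (cleared G p (t + 1)).ncard ≤ (cleared G p t).ncard + k := by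
  calc (cleared G p (t + 1)).ncard
      ≤ (cleared G p t ∪ Set.range (p (t + 1))).ncard := Set.ncard_le_ncard (by
        rw [cleared, Set.union_comm]
        exact Set.union_subset_union_left _ fun v hv => hv.1)
    _ ≤ _ := (Set.ncard_union_le _ _).trans (by gcongr; exact ncard_range_le _)

/-- Beyond `C \ D`, each lion accounts for at most two cleared vertices: the one it reaches and the
one it leaves for a contaminated neighbour. -/
theorem ncard_cleared_succ_add_ncard_innerBoundary_le {V : Type*} [Finite V]
    (G : SimpleGraph V) {k : ℕ} (p : ℕ → Fin k → V) (t : ℕ) :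
    (cleared G p (t + 1)).ncard + (innerBoundary G (cleared G p t)).ncard ≤
      (cleared G p t).ncard + 2 * k := by
  classical
  set C := cleared G p t with hC
  set D := innerBoundary G C with hD
  have hsub : D ⊆ C := fun v hv => hv.1
  -- A lion ending in `C` blocks no contaminated edge; its value here is a dummy.
  let saved : Fin k → V := fun i => if p (t + 1) i ∈ C then p (t + 1) i else p t i
  have hcover : cleared G p (t + 1) ⊆ (C \ D) ∪ (Set.range (p (t + 1)) ∪ Set.range saved) := by
    rintro v (hv | ⟨hv, hv'⟩)
    · exact Or.inr (Or.inl hv)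
    · by_cases hvD : v ∈ D
      · right
        by_cases hq : ∃ i, p (t + 1) i = v
        · exact Or.inl hq
        · obtain ⟨u, hu, hadj⟩ := hvD.2
          have : ∃ i, p t i = v ∧ p (t + 1) i = u := by
            by_contra hcon
            exact hv' ⟨not_exists.1 hq, u, hu, hadj, hcon⟩
          obtain ⟨i, hi, hi'⟩ := this
          refine Or.inr ⟨i, ?_⟩
          simp only [saved]
          rw [if_neg (by rw [hi']; exact hu), hi]
      · exact Or.inl ⟨hv, hvD⟩
  have h1 := Set.ncard_le_ncard hcover
  have h2 := Set.ncard_union_le (C \ D) (Set.range (p (t + 1)) ∪ Set.range saved)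
  have h3 := Set.ncard_union_le (Set.range (p (t + 1))) (Set.range saved)
  have h4 := ncard_range_le (p (t + 1))
  have h5 := ncard_range_le saved
  have h6 := Set.ncard_sdiff_add_ncard_of_subset hsub
  omega

/-! ### The rhombus -/

theorem rhombus_adj_row {n : ℕ} (i j j' : Fin n) (h : j'.val = j.val + 1) :
    (rhombus n).Adj (i, j) (i, j') := by
  rw [rhombus, triangularLattice, SimpleGraph.fromRel_adj]
  refine ⟨fun he => ?_, Or.inl (Or.inl ⟨rfl, h⟩)⟩
  have := congrArg (fun v => v.2.val) he
  simp only at this; omega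

theorem rhombus_adj_col {n : ℕ} (j i i' : Fin n) (h : i'.val = i.val + 1) :
    (rhombus n).Adj (i, j) (i', j) := by
  rw [rhombus, triangularLattice, SimpleGraph.fromRel_adj]
  refine ⟨fun he => ?_, Or.inl (Or.inr (Or.inl ⟨h, rfl⟩))⟩
  have := congrArg (fun v => v.1.val) he
  simp only at this; omega

theorem mem_iff_mem_of_adj {V : Type*} {G : SimpleGraph V} {C : Set V} {u v : V}
    (h : G.Adj u v) (hu : u ∉ innerBoundary G C) (hv : v ∉ innerBoundary G C) :
    u ∈ C ↔ v ∈ C :=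
  ⟨fun h1 => by_contra fun h2 => hu ⟨h1, v, h2, h⟩,
    fun h1 => by_contra fun h2 => hv ⟨h1, u, h2, h.symm⟩⟩

theorem le_ncard_innerBoundary_rhombus {n : ℕ} (C : Set (Fin n × Fin n))
    (h1 : (n - 1) * n < 2 * C.ncard) (h2 : 2 * C.ncard ≤ n * n) :
    n ≤ (innerBoundary (rhombus n) C).ncard := by
  classical
  by_contra! hlt
  rw [Set.ncard_eq_toFinset_card'] at h1 h2 hlt
  have hn : 0 < n := by omega
  have hmul : (n - 1) * n < n * n := Nat.mul_lt_mul_of_pos_right (by omega) hn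
  have hc := card_add_card_compl C.toFinset
  rw [Fintype.card_prod, Fintype.card_fin] at hc
  have := isoperimetric C.toFinset (innerBoundary (rhombus n) C).toFinset
    (fun i j j' h hj hj' => by
      simp only [Set.mem_toFinset] at *
      exact mem_iff_mem_of_adj (rhombus_adj_row i j j' h) hj hj')
    (fun j i i' h hi hi' => by
      simp only [Set.mem_toFinset] at *
      exact mem_iff_mem_of_adj (rhombus_adj_col j i i' h) hi hi') hlt
  -- `h2` makes the complement at least half of all vertices, so it is not the small side either.
  omega

theorem two_mul_ncard_cleared_rhombus_le {n k : ℕ} (hk : k ≤ n / 2)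
    (p : ℕ → Fin k → Fin n × Fin n) (t : ℕ) :
    2 * (cleared (rhombus n) p t).ncard ≤ (n - 1) * n + 2 * k := by
  induction t with
  | zero =>
    have : (cleared (rhombus n) p 0).ncard ≤ k := ncard_range_le (p 0)
    omega
  | succ t ih =>
    by_cases h : 2 * (cleared (rhombus n) p t).ncard ≤ (n - 1) * n
    · have := ncard_cleared_succ_le (rhombus n) p t
      omega
    · have hn : (n - 1) * n + n ≤ n * n := by
        rcases n with _ | n
        · simp
        · simp only [Nat.add_sub_cancel]; nlinarith
      have h1 := le_ncard_innerBoundary_rhombus (cleared (rhombus n) p t) (by omega) (by omega)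
      have h2 := ncard_cleared_succ_add_ncard_innerBoundary_le (rhombus n) p t
      omega

end Lions

theorem mainTheorem3 (n : ℕ) (hn : 1 ≤ n) (k : ℕ) (hk : k ≤ n / 2) :
    ¬ Lions.CanClear (Lions.rhombus n) k := by
  rintro ⟨p, -, t, ht⟩
  have h := Lions.two_mul_ncard_cleared_rhombus_le hk p t
  rw [ht, Set.ncard_univ, Nat.card_prod, Nat.card_fin] at h
  obtain ⟨m, rfl⟩ := Nat.exists_eq_add_of_le' hn
  simp only [Nat.add_sub_cancel] at h
  have : 2 * k ≤ m + 1 := by omega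
  nlinarith
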